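/- Let $n\ge 1$. An octahedral system $\Omega=(V_1,\ldots,V_n,E)$ consists of pairwise disjoint finite sets $V_1,\ldots,V_n$ with $|V_i|\ge 2$ for all $i$, and a set $E$ of subsets (edges) of $\bigcup_{i=1}^n V_i$, each edge meeting each $V_i$ in exactly one vertex, such that for every $X\subseteq\bigcup_{i=1}^n V_i$ with $|X\cap V_i|=2$ for $i=1,\ldots,n$, the number of edges $e\in E$ with $e\subseteq X$ is even. It is an $(m_1,\ldots,m_n)$-octahedral system if $|V_i|=m_i$ for all $i$, and it is without isolated vertex if each vertex of $\bigcup_{i=1}^n V_i$ belongs to at least one edge. **Proposition.** Let $n,k,z$ be integers with $2\le k\le n$ and $0\le z<k$. Let $\Omega=(V_1,\ldots,V_n,E)$ be an $(m_1,\ldots,m_n)$-octahedral system without isolated vertex such that $m_i=k-1$ for $1\le i\le z$, $m_i=k$ for $z<i\le k$, and $k\le m_{k+1}\le\cdots\le m_n$ (the last condition being void if $k=n$). Then $$|E|\ \ge\ \begin{cases}\frac12k^2+\frac12k-8+|V_{n-1}|+|V_n|-z & \text{if } k\le n-2,\\[2pt] \frac12n^2+\frac12n-10+|V_n|-z & \text{if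 } k=n-1,\\[2pt] \frac12n^2+\frac52n-11-z & \text{if } k=n.\end{cases}$$ -/

import Mathlib

/-- An octahedral system with colour classes `V₁, …, Vₙ` (`part`, indexed by `Fin n`, i.e. from `0`)
and edge set `E`: an `n`-uniform `n`-partite hypergraph whose classes are pairwise disjoint finite
sets with at least two elements, whose edges are subsets of `⋃ Vᵢ` meeting each `Vᵢ` in exactly one
vertex, and which satisfies the parity condition. -/
structure OctahedralSystem (α : Type*) [DecidableEq α] (n : ℕ) where
  /-- the colour classes -/
  part : Fin n → Finset α
  /-- the edges, as sets of vertices -/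
  edges : Finset (Finset α)
  part_disjoint : ∀ i j : Fin n, i ≠ j → Disjoint (part i) (part j)
  two_le_card_part : ∀ i : Fin n, 2 ≤ (part i).card
  edge_subset : ∀ e ∈ edges, e ⊆ Finset.univ.biUnion part
  card_edge_inter_part : ∀ e ∈ edges, ∀ i : Fin n, (e ∩ part i).card = 1
  /-- If `X` has exactly two vertices in each class, then `X` induces an even number of edges. -/
  parity : ∀ X : Finset α, X ⊆ Finset.univ.biUnion part →
    (∀ i : Fin n, (X ∩ part i).card = 2) → Even (edges.filter (fun e => e ⊆ X)).card

namespace OctahedralSystem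

variable {α : Type*} [DecidableEq α] {n : ℕ}

/-- `Ω` is an `(m₁, …, mₙ)`-octahedral system. -/
def HasSizes (Ω : OctahedralSystem α n) (m : Fin n → ℕ) : Prop :=
  ∀ i : Fin n, (Ω.part i).card = m i

/-- Each vertex belongs to at least one edge. -/
def WithoutIsolatedVertex (Ω : OctahedralSystem α n) : Prop :=
  ∀ v ∈ Finset.univ.biUnion Ω.part, ∃ e ∈ Ω.edges, v ∈ e

end OctahedralSystem

/-! View the edge set as the support of an `𝔽₂`-valued function on tuples of vertices; parity says
that its sum over every combinatorial cube vanishes. A slice need not keep this property, but the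
sum of two slices in one class does. So one zero slice forces parity on all slices of its class, and
a nonzero parity function has support at least the smallest class size (`le_weight`). If it meets
every vertex of two classes `p`, `q`, its support is at least `|V_p| + |V_q| - 2`
(`card_add_card_le_weight`).

The quadratic term comes from deleting vertices outside `p` and `q`
(`card_add_card_add_sum_le_weight`). A deletion isolating no vertex loses at least one edge and
creates at most one class with fewer than `k` vertices. Once `min k (n - 2)` classes are that small,
`k` drops by one and the bound gains this amount.

If no deletion is possible in a class with at least `k` vertices, each `v` in it owns a private
vertex, all of whose edges contain `v`. The slices at the `v` are then compared by the equivalence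
relations `Tied`. Either some class has all slices tied, which makes all its degrees large, or the
private vertices lie in distinct classes and pairs of slices have large total support. Both give the
bound directly (`bound_of_private_vertices`). -/

open Finset

namespace OctahedralSystem

/-! ### Parity functions on boxes and their slices -/

section Box

variable {ι α : Type*} [DecidableEq ι]

/-- The function `g` with its coordinate `j` fixed to `w`. -/
def slice (j : ι) (w : α) (g : (ι → α) → ZMod 2) : (ι → α) → ZMod 2 :=
  fun x => g (Function.update x j w)

lemma slice_comm {p q : ι} (hpq : p ≠ q) (s t : α) (g : (ι → α) → ZMod 2) :
    slice p t (slice q s g) = slice q s (slice p t g) := by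
  funext x
  simp only [slice]
  rw [Function.update_comm hpq]

omit [DecidableEq ι] in
lemma add_add_cancel_right_char_two (a b c : (ι → α) → ZMod 2) : (a + b) + (b + c) = a + c := by
  funext x
  have := CharTwo.add_self_eq_zero (b x)
  simp only [Pi.add_apply]
  linear_combination this

variable [Fintype ι]

/-- The points whose coordinates in `S` lie in the classes `V`, the others being those of `o`. -/
def box (V : ι → Finset α) (o : ι → α) (S : Finset ι) : Finset (ι → α) :=
  Fintype.piFinset fun l => if l ∈ S then V l else {o l}

/-- The size of the support of `g` on the box. -/
def weight (V : ι → Finset α) (o : ι → α) (S : Finset ι) (g : (ι → α) → ZMod 2) : ℕ :=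
  #{x ∈ box V o S | g x ≠ 0}

/-- The parity condition for a function on the classes indexed by `S`. -/
def IsOct (V : ι → Finset α) (o : ι → α) (S : Finset ι) (g : (ι → α) → ZMod 2) : Prop :=
  ∀ a ∈ box V o S, ∀ b ∈ box V o S, ∑ T ∈ S.powerset, g (T.piecewise a b) = 0

/-- Each vertex of the class `j` meets the support of `g`. -/
def Full (V : ι → Finset α) (o : ι → α) (S : Finset ι) (j : ι) (g : (ι → α) → ZMod 2) : Prop :=
  ∀ w ∈ V j, weight V o (S.erase j) (slice j w g) ≠ 0

variable {V : ι → Finset α} {o : ι → α} {S : Finset ι} {g h : (ι → α) → ZMod 2} {κ : ℕ}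

lemma mem_box {x : ι → α} :
    x ∈ box V o S ↔ (∀ l ∈ S, x l ∈ V l) ∧ ∀ l, l ∉ S → x l = o l := by
  simp only [box, Fintype.mem_piFinset]
  constructor
  · intro hx
    refine ⟨fun l hl => ?_, fun l hl => ?_⟩
    · simpa [hl] using hx l
    · simpa [hl] using hx l
  · rintro ⟨h1, h2⟩ l
    by_cases hl : l ∈ S
    · simpa [hl] using h1 l hl
    · simpa [hl] using h2 l hl

lemma update_mem_box {j : ι} (hj : j ∈ S) {w : α} (hw : w ∈ V j) {x : ι → α}
    (hx : x ∈ box V o (S.erase j)) : Function.update x j w ∈ box V o S := by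
  rw [mem_box] at hx ⊢
  refine ⟨fun l hl => ?_, fun l hl => ?_⟩
  · by_cases h : l = j
    · subst h; simpa using hw
    · simpa [h] using hx.1 l (by simp [h, hl])
  · have h : l ≠ j := fun h => hl (h ▸ hj)
    simpa [h] using hx.2 l (by simp [hl])

lemma piecewise_mem_box {T : Finset ι} {a b : ι → α} (ha : a ∈ box V o S) (hb : b ∈ box V o S) :
    T.piecewise a b ∈ box V o S := by
  rw [mem_box] at ha hb ⊢
  refine ⟨fun l hl => ?_, fun l hl => ?_⟩ <;> by_cases h : l ∈ T <;>
    simp [h, ha.1, hb.1, ha.2, hb.2, hl]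

lemma weight_ne_zero : weight V o S g ≠ 0 ↔ ∃ x ∈ box V o S, g x ≠ 0 := by
  simp [weight, Finset.card_eq_zero, Finset.filter_eq_empty_iff]

lemma weight_eq_zero : weight V o S g = 0 ↔ ∀ x ∈ box V o S, g x = 0 := by
  simp [weight, Finset.card_eq_zero, Finset.filter_eq_empty_iff]

lemma weight_add_le : weight V o S (g + h) ≤ weight V o S g + weight V o S h := by
  classical
  unfold weight
  refine le_trans (card_le_card ?_) (card_union_le _ _)
  intro x
  simp only [mem_filter, mem_union, Pi.add_apply]
  rintro ⟨hx, hne⟩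
  by_cases hg : g x = 0
  · right; exact ⟨hx, by simpa [hg] using hne⟩
  · left; exact ⟨hx, hg⟩

lemma weight_slice {j : ι} (hj : j ∈ S) (g : (ι → α) → ZMod 2) :
    weight V o S g = ∑ w ∈ V j, weight V o (S.erase j) (slice j w g) := by
  classical
  unfold weight
  rw [card_eq_sum_card_fiberwise (f := fun x : ι → α => x j) (t := V j)]
  · refine sum_congr rfl fun w hw => ?_
    refine card_bij' (fun x _ => Function.update x j (o j)) (fun y _ => Function.update y j w)
      ?_ ?_ ?_ ?_
    · intro x hx
      simp only [mem_filter] at hx ⊢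
      obtain ⟨⟨hx, hg⟩, rfl⟩ := hx
      refine ⟨?_, by simpa [slice] using hg⟩
      rw [mem_box] at hx ⊢
      refine ⟨fun l hl => ?_, fun l hl => ?_⟩
      · have := mem_erase.1 hl
        simpa [this.1] using hx.1 l this.2
      · by_cases h : l = j
        · subst h; simp
        · simpa [h] using hx.2 l (fun h' => hl (by simp [h, h']))
    · intro y hy
      simp only [mem_filter] at hy ⊢
      exact ⟨⟨update_mem_box hj hw hy.1, hy.2⟩, by simp⟩
    · intro x hx
      simp only [mem_filter] at hx
      simp [← hx.2]
    · intro y hy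
      simp only [mem_filter] at hy
      have := (mem_box.1 hy.1).2 j (by simp)
      simp [← this]
  · intro x hx
    simp only [coe_filter, Set.mem_ofPred_eq] at hx
    exact (mem_box.1 hx.1).1 j hj

lemma weight_slice_slice {p q : ι} (hp : p ∈ S) (hpq : p ≠ q) (s : α)
    (g : (ι → α) → ZMod 2) :
    weight V o (S.erase q) (slice q s g) =
      ∑ t ∈ V p, weight V o ((S.erase p).erase q) (slice q s (slice p t g)) := by
  rw [weight_slice (mem_erase.2 ⟨hpq, hp⟩)]
  refine sum_congr rfl fun t _ => ?_
  rw [slice_comm hpq, erase_right_comm]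

lemma weight_slice_le {j : ι} (hj : j ∈ S) {w : α} (hw : w ∈ V j) :
    weight V o (S.erase j) (slice j w g) ≤ weight V o S g := by
  rw [weight_slice hj g]
  exact single_le_sum (f := fun w => weight V o (S.erase j) (slice j w g))
    (fun _ _ => Nat.zero_le _) hw

lemma IsOct.add (hg : IsOct V o S g) (hh : IsOct V o S h) : IsOct V o S (g + h) := by
  intro a ha b hb
  simp [sum_add_distrib, hg a ha b hb, hh a ha b hb]

lemma isOct_of_weight_eq_zero (hg : weight V o S g = 0) : IsOct V o S g := fun _ ha _ hb =>
  sum_eq_zero fun _ _ => weight_eq_zero.1 hg _ (piecewise_mem_box ha hb)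

lemma IsOct.of_add (hg : IsOct V o S g) (hgh : IsOct V o S (g + h)) : IsOct V o S h := by
  convert hg.add hgh using 1
  funext x
  have := CharTwo.add_self_eq_zero (g x)
  simp only [Pi.add_apply]
  linear_combination -this

/-- Splitting the subsets of `S` by whether they contain `j` splits a cube sum of `g` into one cube
sum for each slice. -/
lemma IsOct.slice_add (hg : IsOct V o S g) {j : ι} (hj : j ∈ S) {w w' : α} (hw : w ∈ V j)
    (hw' : w' ∈ V j) : IsOct V o (S.erase j) (slice j w g + slice j w' g) := by
  intro a ha b hb
  have key := hg _ (update_mem_box hj hw ha) _ (update_mem_box hj hw' hb)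
  rw [← insert_erase hj, sum_powerset_insert (notMem_erase j S)] at key
  rw [← key, add_comm, ← sum_add_distrib]
  refine sum_congr rfl fun T hT => ?_
  have hjT : j ∉ T := fun h => notMem_erase j S (mem_powerset.1 hT h)
  simp only [Pi.add_apply, slice]
  congr 2
  · funext l
    by_cases h : l = j
    · subst h; simp [hjT]
    · by_cases hl : l ∈ T <;> simp [h, hl]
  · funext l
    by_cases h : l = j
    · subst h; simp
    · by_cases hl : l ∈ T <;> simp [h, hl]

lemma IsOct.slice_of_slice (hg : IsOct V o S g) {j : ι} (hj : j ∈ S) {w w' : α} (hw : w ∈ V j)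
    (hw' : w' ∈ V j) (h : IsOct V o (S.erase j) (slice j w g)) :
    IsOct V o (S.erase j) (slice j w' g) :=
  h.of_add (hg.slice_add hj hw hw')

lemma IsOct.slice_of_not_full (hg : IsOct V o S g) {j : ι} (hj : j ∈ S) (hf : ¬ Full V o S j g)
    {w : α} (hw : w ∈ V j) : IsOct V o (S.erase j) (slice j w g) := by
  simp only [Full, not_forall, not_not] at hf
  obtain ⟨w', hw', h0⟩ := hf
  exact hg.slice_of_slice hj hw' hw (isOct_of_weight_eq_zero h0)


end Box

/-! ### Lower bounds for the support of one parity function -/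

section Weights

variable {ι α : Type*} [DecidableEq ι] [Fintype ι]
variable {V : ι → Finset α} {o : ι → α} {S : Finset ι} {g h : (ι → α) → ZMod 2} {κ : ℕ}

lemma Full.card_le {j : ι} (hf : Full V o S j g) (hj : j ∈ S) : #(V j) ≤ weight V o S g := by
  rw [weight_slice hj, card_eq_sum_ones]
  exact sum_le_sum fun w hw => Nat.one_le_iff_ne_zero.2 (hf w hw)

lemma le_weight (hκ : ∀ l ∈ S, κ ≤ #(V l)) (hg : IsOct V o S g) (h0 : weight V o S g ≠ 0) :
    κ ≤ weight V o S g := by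
  induction hn : #S generalizing S g with
  | zero =>
    -- With no free coordinate, parity says that `g` vanishes at the only point of the box.
    obtain rfl := card_eq_zero.1 hn
    obtain ⟨x, hx, hgx⟩ := weight_ne_zero.1 h0
    exact absurd (by simpa using hg x hx x hx) hgx
  | succ n ih =>
    obtain ⟨j, hj⟩ : S.Nonempty := card_pos.1 (by omega)
    by_cases hf : Full V o S j g
    · exact (hκ j hj).trans (hf.card_le hj)
    · obtain ⟨w, hw, hne⟩ : ∃ w ∈ V j, weight V o (S.erase j) (slice j w g) ≠ 0 := by
        by_contra! hcon
        exact h0 (by rw [weight_slice hj]; exact sum_eq_zero hcon)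
      refine le_trans (ih (fun l hl => hκ l (mem_of_mem_erase hl)) (hg.slice_of_not_full hj hf hw)
        hne ?_) (weight_slice_le hj hw)
      rw [card_erase_of_mem hj]; omega

/-- If no member is full at `p`, all slices at `p` are parity functions, so a nonzero one over each
vertex contributes `κ`. -/
lemma exists_full_or_mul_card_le {β : Type*} {A : Finset β} {G : β → (ι → α) → ZMod 2}
    (hκ : ∀ l ∈ S, κ ≤ #(V l)) (hG : ∀ a ∈ A, IsOct V o S (G a)) {p : ι} (hp : p ∈ S)
    (hcov : ∀ s ∈ V p, ∃ a ∈ A, weight V o (S.erase p) (slice p s (G a)) ≠ 0) :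
    (∃ a ∈ A, Full V o S p (G a)) ∨ κ * #(V p) ≤ ∑ a ∈ A, weight V o S (G a) := by
  by_cases hf : ∃ a ∈ A, Full V o S p (G a)
  · exact Or.inl hf
  · right
    push Not at hf
    rw [sum_congr rfl fun a _ => weight_slice hp (G a), sum_comm, mul_comm, ← smul_eq_mul]
    refine card_nsmul_le_sum _ _ _ fun s hs => ?_
    obtain ⟨a, ha, hne⟩ := hcov s hs
    exact (le_weight (fun l hl => hκ l (mem_of_mem_erase hl))
      ((hG a ha).slice_of_not_full hp (hf a ha) hs) hne).trans
      (single_le_sum (f := fun a => weight V o (S.erase p) (slice p s (G a)))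
        (fun _ _ => Nat.zero_le _) ha)

lemma add_card_sub_le_sum {β : Type*} [DecidableEq β] {A : Finset β} {d : β → ℕ} {m c : ℕ}
    (hd : ∀ a ∈ A, m ≤ d a) {a : β} (ha : a ∈ A) (hc : c ≤ d a) :
    c + (#A - 1) * m ≤ ∑ a ∈ A, d a := by
  rw [← add_sum_erase A d ha, ← card_erase_of_mem ha, ← smul_eq_mul]
  exact add_le_add hc (card_nsmul_le_sum _ _ _ fun x hx => hd x (mem_of_mem_erase hx))

lemma add_card_sub_two_le_sum {β : Type*} [DecidableEq β] {A : Finset β} {d : β → ℕ} {m c : ℕ}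
    (hd : ∀ a ∈ A, m ≤ d a) {a b : β} (ha : a ∈ A) (hb : b ∈ A) (hab : a ≠ b)
    (hc : c ≤ d a + d b) : c + (#A - 2) * m ≤ ∑ a ∈ A, d a := by
  have h1 := add_card_sub_le_sum (c := d b) (fun x hx => hd x (mem_of_mem_erase hx))
    (mem_erase.2 ⟨hab.symm, hb⟩) le_rfl
  rw [← add_sum_erase A d ha]
  rw [card_erase_of_mem ha, Nat.sub_sub, one_add_one_eq_two] at h1
  omega

lemma card_add_card_le_weight (h2 : ∀ l ∈ S, 2 ≤ #(V l)) (hg : IsOct V o S g) {p q : ι}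
    (hp : p ∈ S) (hq : q ∈ S) (hpq : p ≠ q) (hfp : Full V o S p g) (hfq : Full V o S q g) :
    #(V p) + #(V q) ≤ weight V o S g + 2 := by
  classical
  have hpq2 := h2 p hp
  have hqq2 := h2 q hq
  have hq' : q ∈ S.erase p := mem_erase.2 ⟨hpq.symm, hq⟩
  by_cases hex : ∃ t ∈ V p, ∃ t' ∈ V p, Full V o (S.erase p) q (slice p t g + slice p t' g)
  · obtain ⟨t, ht, t', ht', hf⟩ := hex
    have hle := (hf.card_le hq').trans weight_add_le
    have hne : t ≠ t' := by
      rintro rfl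
      have h0 : slice p t g + slice p t g = 0 := by
        funext x; exact CharTwo.add_self_eq_zero _
      obtain ⟨s, hs⟩ : (V q).Nonempty := card_pos.1 (by omega)
      rw [h0] at hf
      exact hf s hs (weight_eq_zero.2 fun _ _ => rfl)
    have := add_card_sub_two_le_sum (m := 1) (fun t ht => Nat.one_le_iff_ne_zero.2 (hfp t ht))
      ht ht' hne hle
    rw [weight_slice hp]
    omega
  -- Now the double slices over a fixed `s` agree modulo parity functions.
  · push Not at hex
    have hoct : ∀ t ∈ V p, ∀ t' ∈ V p, ∀ s ∈ V q,
        IsOct V o ((S.erase p).erase q) (slice q s (slice p t g) + slice q s (slice p t' g)) :=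
      fun t ht t' ht' s hs => (hg.slice_add hp ht ht').slice_of_not_full hq' (hex t ht t' ht') hs
    by_cases hs : ∃ s ∈ V q, ∀ t ∈ V p,
        weight V o ((S.erase p).erase q) (slice q s (slice p t g)) ≠ 0
    · obtain ⟨s, hs, hall⟩ := hs
      have hle : #(V p) ≤ weight V o (S.erase q) (slice q s g) := by
        rw [weight_slice_slice hp hpq, card_eq_sum_ones]
        exact sum_le_sum fun t ht => Nat.one_le_iff_ne_zero.2 (hall t ht)
      have := add_card_sub_le_sum (m := 1) (fun s hs => Nat.one_le_iff_ne_zero.2 (hfq s hs)) hs hle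
      rw [weight_slice hq]
      omega
    -- Each `s` has a zero double slice, so all double slices are parity functions. Every vertex of
    -- both classes then has degree at least 2, and averaging the two counts suffices.
    · push Not at hs
      have hall : ∀ s ∈ V q, ∀ t ∈ V p,
          IsOct V o ((S.erase p).erase q) (slice q s (slice p t g)) := by
        intro s hs' t ht
        obtain ⟨t', ht', h0⟩ := hs s hs'
        exact (isOct_of_weight_eq_zero h0).of_add (hoct t' ht' t ht s hs')
      have h2' : ∀ l ∈ (S.erase p).erase q, 2 ≤ #(V l) := fun l hl =>
        h2 l (mem_of_mem_erase (mem_of_mem_erase hl))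
      have hq2 : ∀ s ∈ V q, 2 ≤ weight V o (S.erase q) (slice q s g) := by
        intro s hs'
        have hne := hfq s hs'
        rw [weight_slice_slice hp hpq] at hne ⊢
        obtain ⟨t, ht, htne⟩ := exists_ne_zero_of_sum_ne_zero hne
        exact (le_weight h2' (hall s hs' t ht) htne).trans (single_le_sum
          (f := fun t => weight V o ((S.erase p).erase q) (slice q s (slice p t g)))
          (fun _ _ => Nat.zero_le _) ht)
      have hp2 : ∀ t ∈ V p, 2 ≤ weight V o (S.erase p) (slice p t g) := by
        intro t ht
        have hne := hfp t ht
        rw [weight_slice hq'] at hne ⊢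
        obtain ⟨s, hs', hsne⟩ := exists_ne_zero_of_sum_ne_zero hne
        exact (le_weight h2' (hall s hs' t ht) hsne).trans (single_le_sum
          (f := fun s => weight V o ((S.erase p).erase q) (slice q s (slice p t g)))
          (fun _ _ => Nat.zero_le _) hs')
      have e1 := card_nsmul_le_sum _ _ _ hq2
      have e2 := card_nsmul_le_sum _ _ _ hp2
      rw [← weight_slice hq, smul_eq_mul] at e1
      rw [← weight_slice hp, smul_eq_mul] at e2
      omega

end Weights

/-! ### Families of functions whose pairwise sums are parity functions -/

section Family

variable {ι α β : Type*} [DecidableEq ι] [Fintype ι]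
variable {V : ι → Finset α} {o : ι → α} {S : Finset ι} {κ : ℕ}
variable {I : Finset β} {F : β → (ι → α) → ZMod 2}

/-- The slices at the class `j` of the members `v` and `v'` of the family `F` are congruent modulo
functions that satisfy the parity condition. -/
def Tied (V : ι → Finset α) (o : ι → α) (S : Finset ι) (F : β → (ι → α) → ZMod 2) (j : ι)
    (v v' : β) : Prop :=
  ∀ w ∈ V j, IsOct V o (S.erase j) (slice j w (F v + F v'))

lemma tied_of_slice {j : ι} (hj : j ∈ S) {v v' : β} (hF : IsOct V o S (F v + F v')) {w : α}
    (hw : w ∈ V j) (h : IsOct V o (S.erase j) (slice j w (F v + F v'))) : Tied V o S F j v v' :=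
  fun _ hw' => hF.slice_of_slice hj hw hw' h

lemma Tied.symm {j : ι} {v v' : β} (h : Tied V o S F j v v') : Tied V o S F j v' v := by
  unfold Tied
  rwa [add_comm]

lemma Tied.trans {j : ι} {u v w : β} (h : Tied V o S F j u v) (h' : Tied V o S F j v w) :
    Tied V o S F j u w := by
  intro x hx
  rw [← add_add_cancel_right_char_two _ (F v)]
  exact (h x hx).add (h' x hx)

lemma full_of_not_tied {j : ι} (hj : j ∈ S) {v v' : β} (hF : IsOct V o S (F v + F v'))
    (h : ¬ Tied V o S F j v v') : Full V o S j (F v + F v') := fun _ hw h0 =>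
  h (tied_of_slice hj hF hw (isOct_of_weight_eq_zero h0))

lemma sum_weight_eq {j : ι} (hj : j ∈ S) : ∑ v ∈ I, weight V o S (F v) =
    ∑ w ∈ V j, ∑ v ∈ I, weight V o (S.erase j) (slice j w (F v)) := by
  rw [sum_congr rfl fun v _ => weight_slice hj (F v), sum_comm]

lemma weight_add_le_sum {G : β → (ι → α) → ZMod 2} {v v' : β} (hv : v ∈ I) (hv' : v' ∈ I)
    (hne : v ≠ v') : weight V o S (G v + G v') ≤ ∑ v ∈ I, weight V o S (G v) := by
  classical
  refine weight_add_le.trans ?_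
  rw [← sum_pair (f := fun v => weight V o S (G v)) hne]
  exact sum_le_sum_of_subset (by simp [insert_subset_iff, hv, hv'])

/-- Either all members contribute at `w`, or a zero slice makes every slice at `w` a parity function
and `le_weight` applies. -/
lemma le_degree (hκ : ∀ l ∈ S, κ ≤ #(V l)) (hI : κ ≤ #I) {j : ι}
    (hT : ∀ v ∈ I, ∀ v' ∈ I, Tied V o S F j v v') {w : α} (hw : w ∈ V j)
    (hcov : ∃ v ∈ I, weight V o (S.erase j) (slice j w (F v)) ≠ 0) :
    κ ≤ ∑ v ∈ I, weight V o (S.erase j) (slice j w (F v)) := by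
  by_cases h0 : ∃ v ∈ I, weight V o (S.erase j) (slice j w (F v)) = 0
  · obtain ⟨v, hv, h0⟩ := h0
    obtain ⟨v', hv', hne⟩ := hcov
    have := (isOct_of_weight_eq_zero h0).of_add (hT v hv v' hv' w hw)
    exact (le_weight (fun l hl => hκ l (mem_of_mem_erase hl)) this hne).trans
      (single_le_sum (f := fun v => weight V o (S.erase j) (slice j w (F v)))
        (fun _ _ => Nat.zero_le _) hv')
  · push Not at h0
    refine hI.trans ?_
    rw [card_eq_sum_ones]
    exact sum_le_sum fun v hv => Nat.one_le_iff_ne_zero.2 (h0 v hv)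

lemma bound_of_mul_le {a b W : ℕ} (h2 : 2 ≤ κ) (ha : κ ≤ a) (hb : κ ≤ b) (h1 : κ * a ≤ W)
    (h3 : κ * b ≤ W) : a + b + κ ^ 2 ≤ W + 2 * κ := by
  rcases le_total a b with h | h <;> nlinarith [Nat.mul_le_mul h2 ha, Nat.mul_le_mul h2 hb]

lemma bound_of_add_mul_le {a b W : ℕ} (h2 : 2 ≤ κ) (hb : κ ≤ b)
    (h : a + (b - 1) * κ ≤ W) : a + b + κ ^ 2 ≤ W + 2 * κ := by
  obtain ⟨c, rfl⟩ := Nat.exists_eq_add_of_le hb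
  obtain ⟨d, rfl⟩ := Nat.exists_eq_add_of_le h2
  have : 2 + d + c - 1 = 1 + d + c := by omega
  rw [this] at h
  nlinarith [Nat.zero_le (d * c)]

variable (hF : ∀ v ∈ I, ∀ v' ∈ I, IsOct V o S (F v + F v')) (h2 : 2 ≤ κ)
  (hκ : ∀ l ∈ S, κ ≤ #(V l)) (hI : κ ≤ #I)
  (hcov : ∀ j ∈ S, ∀ w ∈ V j, ∃ v ∈ I, weight V o (S.erase j) (slice j w (F v)) ≠ 0)

include hκ hI hcov in
lemma mul_card_le_sum_weight {j : ι} (hj : j ∈ S)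
    (hT : ∀ v ∈ I, ∀ v' ∈ I, Tied V o S F j v v') :
    κ * #(V j) ≤ ∑ v ∈ I, weight V o S (F v) := by
  rw [sum_weight_eq hj, mul_comm, ← smul_eq_mul]
  exact card_nsmul_le_sum _ _ _ fun w hw => le_degree hκ hI hT hw (hcov j hj w hw)

-- All degrees in class `p` are at least `κ`. An untied pair at `q` has a sum full at `q`: either
-- one vertex of `V p` alone carries `#(V q)`, or the support is at least `κ * #(V q)`.
include hF h2 hκ hI hcov in
lemma bound_of_tied {p q : ι} (hp : p ∈ S) (hq : q ∈ S) (hpq : p ≠ q)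
    (hT : ∀ v ∈ I, ∀ v' ∈ I, Tied V o S F p v v') :
    #(V p) + #(V q) + κ ^ 2 ≤ ∑ v ∈ I, weight V o S (F v) + 2 * κ := by
  classical
  have hWp := mul_card_le_sum_weight hκ hI hcov hp hT
  by_cases hTq : ∀ v ∈ I, ∀ v' ∈ I, Tied V o S F q v v'
  · exact bound_of_mul_le h2 (hκ p hp) (hκ q hq) hWp
      (mul_card_le_sum_weight hκ hI hcov hq hTq)
  · push Not at hTq
    obtain ⟨v, hv, v', hv', hnt⟩ := hTq
    have hne : v ≠ v' := by
      rintro rfl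
      refine hnt fun w _ => isOct_of_weight_eq_zero (weight_eq_zero.2 fun x _ => ?_)
      exact CharTwo.add_self_eq_zero _
    have hfull := full_of_not_tied hq (hF v hv v' hv') hnt
    have hq' : q ∈ S.erase p := mem_erase.2 ⟨hpq.symm, hq⟩
    rcases exists_full_or_mul_card_le (o := o) (A := V p)
      (G := fun s => slice p s (F v + F v')) (κ := κ) (p := q)
      (fun l hl => hκ l (mem_of_mem_erase hl))
      (hT v hv v' hv') hq' (fun t ht => by
        have := hfull t ht
        rw [weight_slice_slice hp hpq] at this
        exact exists_ne_zero_of_sum_ne_zero this) with ⟨s, hs, hf⟩ | hle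
    · have h1 := (hf.card_le hq').trans
        (weight_add_le_sum (G := fun v => slice p s (F v)) hv hv' hne)
      have h3 := add_card_sub_le_sum (fun w hw => le_degree hκ hI hT hw (hcov p hp w hw)) hs h1
      rw [← sum_weight_eq hp] at h3
      rw [add_comm #(V p)]
      exact bound_of_add_mul_le h2 (hκ p hp) h3
    · rw [← weight_slice hp] at hle
      exact bound_of_mul_le h2 (hκ p hp) (hκ q hq) hWp
        (hle.trans (weight_add_le_sum hv hv' hne))

/-- If `g` is full at `p` and `q`, satisfies the parity condition on all its slices at `j`, and no
such slice is full at `q`, then it has a large support. -/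
lemma bound_of_slices_not_full {g : (ι → α) → ZMod 2} {j p q : ι} (h2 : 2 ≤ κ)
    (hκ : ∀ l ∈ S, κ ≤ #(V l)) (hj : j ∈ S) (hp : p ∈ S)
    (hq : q ∈ S) (hpq : p ≠ q) (hjp : j ≠ p) (hjq : j ≠ q)
    (hoct : ∀ w ∈ V j, IsOct V o (S.erase j) (slice j w g))
    (hfp : Full V o S p g) (hfq : Full V o S q g)
    (hnf : ∀ w ∈ V j, ¬ Full V o (S.erase j) q (slice j w g)) :
    #(V p) + #(V q) + κ ^ 2 ≤ weight V o S g + 2 * κ := by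
  classical
  have hq' : q ∈ S.erase j := mem_erase.2 ⟨hjq.symm, hq⟩
  have hp' : p ∈ (S.erase j).erase q := mem_erase.2 ⟨hpq, mem_erase.2 ⟨hjp.symm, hp⟩⟩
  have hκ' : ∀ l ∈ S.erase j, κ ≤ #(V l) := fun l hl => hκ l (mem_of_mem_erase hl)
  have hκ'' : ∀ l ∈ (S.erase j).erase q, κ ≤ #(V l) := fun l hl => hκ' l (mem_of_mem_erase hl)
  have hoct2 : ∀ w ∈ V j, ∀ t ∈ V q,
      IsOct V o ((S.erase j).erase q) (slice q t (slice j w g)) := fun w hw t ht =>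
    (hoct w hw).slice_of_not_full hq' (hnf w hw) ht
  have hdeg : ∀ t ∈ V q, κ ≤ weight V o (S.erase q) (slice q t g) := by
    intro t ht
    have hne := hfq t ht
    rw [weight_slice_slice hj hjq] at hne ⊢
    obtain ⟨w, hw, hwne⟩ := exists_ne_zero_of_sum_ne_zero hne
    exact (le_weight hκ'' (hoct2 w hw t ht) hwne).trans (single_le_sum
      (f := fun w => weight V o ((S.erase j).erase q) (slice q t (slice j w g)))
      (fun _ _ => Nat.zero_le _) hw)
  have hW : weight V o S g = ∑ x ∈ V j ×ˢ V q,
      weight V o ((S.erase j).erase q) (slice q x.2 (slice j x.1 g)) := by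
    rw [sum_product, weight_slice hj]
    exact sum_congr rfl fun w _ => weight_slice hq' _
  rcases exists_full_or_mul_card_le (o := o) (A := V j ×ˢ V q)
      (G := fun x => slice q x.2 (slice j x.1 g)) (κ := κ) (p := p) hκ''
      (fun x hx => hoct2 x.1 (mem_product.1 hx).1 x.2 (mem_product.1 hx).2) hp' (fun s hs => by
        have hne := hfp s hs
        rw [weight_slice_slice hj hjp] at hne
        obtain ⟨w, hw, hwne⟩ := exists_ne_zero_of_sum_ne_zero hne
        rw [weight_slice_slice hq' hpq.symm] at hwne
        obtain ⟨t, ht, htne⟩ := exists_ne_zero_of_sum_ne_zero hwne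
        exact ⟨(w, t), mem_product.2 ⟨hw, ht⟩, htne⟩) with ⟨x, hx, hf⟩ | hle
  · obtain ⟨hw, ht⟩ := mem_product.1 hx
    have h1 : #(V p) ≤ weight V o (S.erase q) (slice q x.2 g) := by
      refine (hf.card_le hp').trans ?_
      rw [weight_slice_slice hj hjq]
      exact single_le_sum
        (f := fun w => weight V o ((S.erase j).erase q) (slice q x.2 (slice j w g)))
        (fun _ _ => Nat.zero_le _) hw
    have h3 := add_card_sub_le_sum hdeg ht h1
    rw [← weight_slice hq] at h3
    exact bound_of_add_mul_le h2 (hκ q hq) h3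
  · rw [← hW] at hle
    refine bound_of_mul_le h2 (hκ p hp) (hκ q hq) hle ?_
    rw [weight_slice hq, mul_comm, ← smul_eq_mul]
    exact card_nsmul_le_sum _ _ _ hdeg

-- Class `j` supplies degrees at least `κ`; the sum of the untied pair is full at `p` and `q`, which
-- raises one or two of these degrees or makes the whole support large.
include hF h2 hκ hI hcov in
lemma bound_of_tied_of_not_tied {j p q : ι} (hj : j ∈ S) (hp : p ∈ S) (hq : q ∈ S) (hpq : p ≠ q)
    (hjp : j ≠ p) (hjq : j ≠ q) (hT : ∀ v ∈ I, ∀ v' ∈ I, Tied V o S F j v v') {v v' : β}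
    (hv : v ∈ I) (hv' : v' ∈ I) (hne : v ≠ v') (hnp : ¬ Tied V o S F p v v')
    (hnq : ¬ Tied V o S F q v v') :
    #(V p) + #(V q) + κ ^ 2 ≤ ∑ v ∈ I, weight V o S (F v) + 2 * κ := by
  classical
  have hfp := full_of_not_tied hp (hF v hv v' hv') hnp
  have hfq := full_of_not_tied hq (hF v hv v' hv') hnq
  have hoct := hT v hv v' hv'
  have hsum := weight_add_le_sum (V := V) (o := o) (S := S) (G := F) hv hv' hne
  have hp' : p ∈ S.erase j := mem_erase.2 ⟨hjp.symm, hp⟩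
  have hq' : q ∈ S.erase j := mem_erase.2 ⟨hjq.symm, hq⟩
  have hdeg := fun w hw => le_degree hκ hI hT hw (hcov j hj w hw)
  have hpair : ∀ w, weight V o (S.erase j) (slice j w (F v + F v')) ≤
      ∑ v ∈ I, weight V o (S.erase j) (slice j w (F v)) := fun w =>
    weight_add_le_sum (G := fun v => slice j w (F v)) hv hv' hne
  have hVj := hκ j hj
  by_cases h1 : ∀ w ∈ V j, ¬ Full V o (S.erase j) q (slice j w (F v + F v'))
  · exact (bound_of_slices_not_full h2 hκ hj hp hq hpq hjp hjq hoct hfp hfq h1).trans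
      (Nat.add_le_add_right hsum _)
  by_cases h3 : ∀ w ∈ V j, ¬ Full V o (S.erase j) p (slice j w (F v + F v'))
  · rw [add_comm #(V p)]
    exact (bound_of_slices_not_full h2 hκ hj hq hp hpq.symm hjq hjp hoct hfq hfp h3).trans
      (Nat.add_le_add_right hsum _)
  push Not at h1 h3
  obtain ⟨w, hw, hwq⟩ := h1
  obtain ⟨w', hw', hwp⟩ := h3
  rw [sum_weight_eq hj]
  -- One vertex of class `j` carries both fullness conditions, or two vertices carry one each.
  by_cases hww : w = w'
  · subst hww
    have h4 := card_add_card_le_weight (fun l hl => h2.trans (hκ l (mem_of_mem_erase hl)))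
      (hoct w hw) hp' hq' hpq hwp hwq
    have h5 := add_card_sub_le_sum hdeg hw (le_refl _)
    have h6 := hpair w
    have h7 : (κ - 1) * κ ≤ (#(V j) - 1) * κ := Nat.mul_le_mul_right _ (by omega)
    obtain ⟨d, rfl⟩ := Nat.exists_eq_add_of_le h2
    rw [show 2 + d - 1 = 1 + d by omega] at h7
    nlinarith
  · have h4 := ((hwq.card_le hq').trans (hpair w))
    have h5 := ((hwp.card_le hp').trans (hpair w'))
    have h6 := add_card_sub_two_le_sum hdeg hw hw' hww (le_refl _)
    have h7 : (κ - 2) * κ ≤ (#(V j) - 2) * κ := Nat.mul_le_mul_right _ (by omega)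
    obtain ⟨d, rfl⟩ := Nat.exists_eq_add_of_le h2
    rw [show 2 + d - 2 = d by omega] at h7
    nlinarith

end Family

/-! ### Private vertices and the induction by deletion -/

section Bound

variable {ι α β : Type*} [DecidableEq ι] [Fintype ι]

/-- At most one term can be deficient, and any other term compensates for it. -/
lemma sum_le_sum_of_pairs {O : Finset β} {c d : β → ℕ} (hO : 2 ≤ #O)
    (h : ∀ x ∈ O, ∀ y ∈ O, x ≠ y → c x + c y ≤ d x + d y) : ∑ x ∈ O, c x ≤ ∑ x ∈ O, d x := by
  classical
  by_cases hall : ∀ x ∈ O, c x ≤ d x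
  · exact sum_le_sum hall
  · push Not at hall
    obtain ⟨x, hx, hlt⟩ := hall
    obtain ⟨y, hy⟩ : (O.erase x).Nonempty := card_pos.1 (by rw [card_erase_of_mem hx]; omega)
    have h1 := h x hx y (mem_of_mem_erase hy) (ne_of_mem_erase hy).symm
    have h2 : ∑ z ∈ (O.erase x).erase y, c z ≤ ∑ z ∈ (O.erase x).erase y, d z :=
      sum_le_sum fun z hz => by
        have := h x hx z (mem_of_mem_erase (mem_of_mem_erase hz))
          (ne_of_mem_erase (mem_of_mem_erase hz)).symm
        omega
    rw [← add_sum_erase O c hx, ← add_sum_erase O d hx, ← add_sum_erase _ c hy,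
      ← add_sum_erase _ d hy]
    omega

/-- Two equivalence relations that each fail somewhere cannot jointly cover all pairs. -/
lemma exists_not_tied_both {V : ι → Finset α} {o : ι → α} {S : Finset ι} {I : Finset β}
    {F : β → (ι → α) → ZMod 2} {p q : ι}
    (hp : ¬ ∀ v ∈ I, ∀ v' ∈ I, Tied V o S F p v v')
    (hq : ¬ ∀ v ∈ I, ∀ v' ∈ I, Tied V o S F q v v') :
    ∃ v ∈ I, ∃ v' ∈ I, ¬ Tied V o S F p v v' ∧ ¬ Tied V o S F q v v' := by
  push Not at hp hq
  obtain ⟨a, ha, b, hb, hab⟩ := hp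
  by_cases h : Tied V o S F q a b
  · have : ∃ c ∈ I, ¬ Tied V o S F q a c := by
      by_contra! hcon
      obtain ⟨x, hx, y, hy, hxy⟩ := hq
      exact hxy ((hcon x hx).symm.trans (hcon y hy))
    obtain ⟨c, hc, hac⟩ := this
    by_cases hpac : Tied V o S F p a c
    · exact ⟨c, hc, b, hb, fun h' => hab (hpac.trans h'), fun h' => hac (h.trans h'.symm)⟩
    · exact ⟨a, ha, c, hc, hpac, hac⟩
  · exact ⟨a, ha, b, hb, hab, h⟩

/-- The bound for a family in which each member is the only one at some vertex. -/
lemma bound_of_private_vertices {V : ι → Finset α} {o : ι → α} {S : Finset ι} {I : Finset β}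
    {F : β → (ι → α) → ZMod 2} {k : ℕ} (hk : 4 ≤ k)
    (hF : ∀ v ∈ I, ∀ v' ∈ I, IsOct V o S (F v + F v'))
    (hκ : ∀ l ∈ S, k - 1 ≤ #(V l)) (hI : k ≤ #I)
    (hcov : ∀ j ∈ S, ∀ w ∈ V j, ∃ v ∈ I, weight V o (S.erase j) (slice j w (F v)) ≠ 0)
    (hpriv : ∀ v ∈ I, ∃ j ∈ S, ∃ u ∈ V j, ∀ v' ∈ I, v' ≠ v →
      weight V o (S.erase j) (slice j u (F v')) = 0)
    {p q : ι} (hp : p ∈ S) (hq : q ∈ S) (hpq : p ≠ q) :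
    #(V p) + #(V q) + (k - 1) ^ 2 ≤ ∑ v ∈ I, weight V o S (F v) + 2 * (k - 1) ∨
    #(V p) + #(V q) + (k - 2) * (k - 1) ≤
      ∑ v ∈ I, weight V o S (F v) + 2 + #{l ∈ S | #(V l) < k} := by
  classical
  have h2 : 2 ≤ k - 1 := by omega
  have hI' : k - 1 ≤ #I := by omega
  by_cases hTp : ∀ v ∈ I, ∀ v' ∈ I, Tied V o S F p v v'
  · exact Or.inl (bound_of_tied hF h2 hκ hI' hcov hp hq hpq hTp)
  by_cases hTq : ∀ v ∈ I, ∀ v' ∈ I, Tied V o S F q v v'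
  · rw [add_comm #(V p)]
    exact Or.inl (bound_of_tied hF h2 hκ hI' hcov hq hp hpq.symm hTq)
  obtain ⟨a, ha, b, hb, hnp, hnq⟩ := exists_not_tied_both hTp hTq
  have hab : a ≠ b := by
    rintro rfl
    refine hnp fun w _ => isOct_of_weight_eq_zero (weight_eq_zero.2 fun x _ => ?_)
    exact CharTwo.add_self_eq_zero _
  have : Nonempty ι := ⟨p⟩
  have : Nonempty α := by
    have := hκ p hp
    obtain ⟨x, -⟩ : (V p).Nonempty := card_pos.1 (by omega)
    exact ⟨x⟩
  choose! j hj u hu h0 using hpriv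
  by_cases hex : ∃ x ∈ I, ∀ v ∈ I, ∀ v' ∈ I, Tied V o S F (j x) v v'
  · obtain ⟨x, hx, hT⟩ := hex
    left
    refine bound_of_tied_of_not_tied hF h2 hκ hI' hcov (hj x hx) hp hq hpq ?_ ?_ hT ha hb hab hnp
      hnq
    · intro h; exact hnp (h ▸ hT a ha b hb)
    · intro h; exact hnq (h ▸ hT a ha b hb)
  right
  -- At `u x` all slices but that of `x` are zero; a tie of `x` with one other member would make
  -- that slice a parity function too, and so tie everything.
  have hsep : ∀ x ∈ I, ∀ y ∈ I, y ≠ x → ¬ Tied V o S F (j x) x y := by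
    intro x hx y hy hyx hT
    refine hex ⟨x, hx, ?_⟩
    have hoct : ∀ v ∈ I, IsOct V o (S.erase (j x)) (slice (j x) (u x) (F v)) := by
      intro v hv
      by_cases hvx : v = x
      · subst hvx
        exact (isOct_of_weight_eq_zero (h0 v hx y hy hyx)).of_add (hT.symm _ (hu v hx))
      · exact isOct_of_weight_eq_zero (h0 x hx v hv hvx)
    exact fun v hv v' hv' => tied_of_slice (hj x hx) (hF v hv v' hv') (hu x hx)
      ((hoct v hv).add (hoct v' hv'))
  -- A third member `v` and `y` both have zero slice at `u x`, so they would be tied in the class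
  -- private to `y`.
  have hinj : ∀ x ∈ I, ∀ y ∈ I, j x = j y → x = y := by
    intro x hx y hy hxy
    by_contra hne
    obtain ⟨v, hv⟩ : ((I.erase x).erase y).Nonempty := card_pos.1 (by
      rw [card_erase_of_mem (mem_erase.2 ⟨Ne.symm hne, hy⟩), card_erase_of_mem hx]; omega)
    have hvI := mem_of_mem_erase (mem_of_mem_erase hv)
    have hvx := ne_of_mem_erase (mem_of_mem_erase hv)
    refine hsep y hy v hvI (ne_of_mem_erase hv) ?_
    rw [← hxy]
    exact tied_of_slice (hj x hx) (hF y hy v hvI) (hu x hx)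
      ((isOct_of_weight_eq_zero (h0 x hx y hy (Ne.symm hne))).add
        (isOct_of_weight_eq_zero (h0 x hx v hvI hvx)))
  have hpair : ∀ {x y}, x ∈ I → y ∈ I → ∀ {r s}, r ∈ S → s ∈ S → r ≠ s →
      ¬ Tied V o S F r x y → ¬ Tied V o S F s x y →
      #(V r) + #(V s) ≤ weight V o S (F x) + weight V o S (F y) + 2 := by
    intro x y hx hy r s hr hs hrs htr hts
    have hxy := hF x hx y hy
    exact (card_add_card_le_weight (fun l hl => h2.trans (hκ l hl)) hxy hr hs hrs
      (full_of_not_tied hr hxy htr) (full_of_not_tied hs hxy hts)).trans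
      (Nat.add_le_add_right weight_add_le 2)
  have h1 := hpair ha hb hp hq hpq hnp hnq
  set O := (I.erase a).erase b with hO
  have hbI : b ∈ I.erase a := mem_erase.2 ⟨hab.symm, hb⟩
  have hOI : O ⊆ I := (erase_subset _ _).trans (erase_subset _ _)
  have hOcard : k - 2 ≤ #O := by
    rw [hO, card_erase_of_mem hbI, card_erase_of_mem ha]; omega
  have hsum : ∑ x ∈ O, (#(V (j x)) - 1) ≤ ∑ x ∈ O, weight V o S (F x) := by
    refine sum_le_sum_of_pairs (by omega) fun x hx y hy hxy => ?_
    have hx := hOI hx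
    have hy := hOI hy
    have := hpair hx hy (hj x hx) (hj y hy) (fun h => hxy (hinj x hx y hy h))
      (hsep x hx y hy hxy.symm) (fun h => hsep y hy x hx hxy h.symm)
    have e1 := hκ _ (hj x hx)
    have e2 := hκ _ (hj y hy)
    omega
  have hsmall : #{x ∈ O | #(V (j x)) < k} ≤ #{l ∈ S | #(V l) < k} := by
    refine card_le_card_of_injOn j ?_ ?_
    · intro x hx
      have hx := mem_filter.1 (mem_coe.1 hx)
      exact mem_coe.2 (mem_filter.2 ⟨hj x (hOI hx.1), hx.2⟩)
    · intro x hx y hy hxy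
      exact hinj x (hOI (mem_filter.1 (mem_coe.1 hx)).1) y (hOI (mem_filter.1 (mem_coe.1 hy)).1) hxy
  -- A term falls short of `k - 1` only when its class has exactly `k - 1` vertices, and then by
  -- one.
  have hlow : (k - 2) * (k - 1) ≤ ∑ x ∈ O, (#(V (j x)) - 1) + #{x ∈ O | #(V (j x)) < k} := by
    rw [card_filter, ← sum_add_distrib]
    refine (Nat.mul_le_mul_right _ hOcard).trans ?_
    rw [← smul_eq_mul]
    refine card_nsmul_le_sum _ _ _ fun x hx => ?_
    have := hκ _ (hj x (hOI hx))
    split_ifs <;> omega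
  rw [← add_sum_erase I _ ha, ← add_sum_erase _ _ hbI, ← hO]
  omega

lemma box_congr {V V' : ι → Finset α} {o : ι → α} {S : Finset ι} (h : ∀ l ∈ S, V l = V' l) :
    box V o S = box V' o S := by
  ext x
  simp only [mem_box]
  refine and_congr_left fun _ => forall₂_congr fun l hl => by rw [h l hl]

lemma weight_congr {V V' : ι → Finset α} {o : ι → α} {S : Finset ι} {g : (ι → α) → ZMod 2}
    (h : ∀ l ∈ S, V l = V' l) : weight V o S g = weight V' o S g := by
  rw [weight, weight, box_congr h]

lemma IsOct.mono {V V' : ι → Finset α} {o : ι → α} {S : Finset ι} {g : (ι → α) → ZMod 2}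
    (hg : IsOct V o S g) (h : ∀ l, V' l ⊆ V l) : IsOct V' o S g := by
  have hsub : ∀ x ∈ box V' o S, x ∈ box V o S := fun x hx => by
    rw [mem_box] at hx ⊢
    exact ⟨fun l hl => h l (hx.1 l hl), hx.2⟩
  exact fun a ha b hb => hg a (hsub a ha) b (hsub b hb)

lemma two_mul_sum_min_add_le (m : ℕ) {k : ℕ} (hk : 3 ≤ k) :
    2 * ∑ l ∈ Icc 4 k, min l m + 12 ≤ k * (k + 1) := by
  induction k, hk using Nat.le_induction with
  | base => simp
  | succ k hk ih =>
    rw [sum_Icc_succ_top (by omega)]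
    have := min_le_left (k + 1) m
    nlinarith

lemma two_mul_sum_min_add {m k : ℕ} (hk : 3 ≤ k) (hkm : k ≤ m) :
    2 * ∑ l ∈ Icc 4 k, min l m + 12 = k * (k + 1) := by
  induction k, hk using Nat.le_induction with
  | base => simp
  | succ k hk ih =>
    rw [sum_Icc_succ_top (by omega), min_eq_left hkm]
    have := ih (by omega)
    nlinarith

/-- The lower bound for a function satisfying the parity condition without isolated vertex: outside
`p` and `q`, vertices are removed one at a time until each removal would isolate a vertex. -/
theorem card_add_card_add_sum_le_weight {f : (ι → α) → ZMod 2} {o : ι → α} {p q : ι} (hpq : p ≠ q)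
    {k : ℕ} {V : ι → Finset α} (hk : 3 ≤ k) (hV : ∀ l, k - 1 ≤ #(V l))
    (hf : IsOct V o univ f) (hfull : ∀ l, Full V o univ l f) :
    #(V p) + #(V q) + ∑ l ∈ Icc 4 k, min l (Fintype.card ι - 2) ≤
      weight V o univ f + 2 + #{l | l ≠ p ∧ l ≠ q ∧ #(V l) < k} := by
  classical
  induction hN : k + ∑ l, #(V l) using Nat.strong_induction_on generalizing k V with
  | _ N ih =>
  obtain rfl | hk4 : k = 3 ∨ 4 ≤ k := by omega
  · have := card_add_card_le_weight (fun l _ => hV l) hf (mem_univ p) (mem_univ q) hpq (hfull p)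
      (hfull q)
    simp only [Icc_eq_empty_of_lt (show 3 < 4 by norm_num), sum_empty]
    omega
  -- No class has fewer than `k - 1` vertices, so passing to `k - 1` empties the set of small
  -- classes; its size pays for the top term of the sum.
  by_cases hZ : min k (Fintype.card ι - 2) ≤ #{l | l ≠ p ∧ l ≠ q ∧ #(V l) < k}
  · have h1 := ih (k - 1 + ∑ l, #(V l)) (by omega) (k := k - 1) (V := V) (by omega)
      (fun l => (Nat.sub_le _ _).trans (hV l)) hf hfull rfl
    have h2 : #{l | l ≠ p ∧ l ≠ q ∧ #(V l) < k - 1} = 0 := by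
      rw [card_eq_zero, filter_eq_empty_iff]
      intro l _ h
      exact absurd h.2.2 (not_lt.2 (hV l))
    obtain ⟨k, rfl⟩ := Nat.exists_eq_add_of_le' (show 1 ≤ k by omega)
    rw [sum_Icc_succ_top (by omega)]
    simp only [Nat.add_sub_cancel] at h1 h2
    omega
  obtain ⟨i, hip, hiq, hi⟩ : ∃ i, i ≠ p ∧ i ≠ q ∧ k ≤ #(V i) := by
    by_contra! hcon
    refine hZ ((min_le_right _ _).trans ?_)
    have : (univ.erase p).erase q ⊆ ({l | l ≠ p ∧ l ≠ q ∧ #(V l) < k} : Finset ι) := by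
      intro l hl
      simp only [mem_erase, mem_univ, and_true] at hl
      exact mem_filter.2 ⟨mem_univ _, hl.2, hl.1, hcon l hl.2 hl.1⟩
    refine le_trans ?_ (card_le_card this)
    rw [card_erase_of_mem (mem_erase.2 ⟨hpq.symm, mem_univ _⟩), card_erase_of_mem (mem_univ _),
      card_univ, Nat.sub_sub]
  have hcongr : ∀ v l, l ≠ i → Function.update V i ((V i).erase v) l = V l := fun v l hl =>
    Function.update_of_ne hl _ _
  by_cases hex : ∃ v ∈ V i, ∀ l, Full (Function.update V i ((V i).erase v)) o univ l f
  · obtain ⟨v, hv, hfull'⟩ := hex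
    have hcg := hcongr v
    have hVi : Function.update V i ((V i).erase v) i = (V i).erase v := Function.update_self ..
    generalize Function.update V i ((V i).erase v) = V' at *
    have hsub : ∀ l, V' l ⊆ V l := fun l => by
      by_cases hl : l = i
      · subst hl; rw [hVi]; exact erase_subset _ _
      · rw [hcg l hl]
    have hcard : #(V' i) + 1 = #(V i) := by rw [hVi]; exact card_erase_add_one hv
    have hlt : ∑ l, #(V' l) < ∑ l, #(V l) :=
      sum_lt_sum (fun l _ => card_le_card (hsub l)) ⟨i, mem_univ _, by omega⟩
    have h1 := ih (k + ∑ l, #(V' l)) (by omega) (k := k) (V := V') hk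
      (fun l => by
        by_cases hl : l = i
        · subst hl; omega
        · rw [hcg l hl]; exact hV l) (hf.mono hsub) hfull' rfl
    have h2 : #{l | l ≠ p ∧ l ≠ q ∧ #(V' l) < k} ≤ #{l | l ≠ p ∧ l ≠ q ∧ #(V l) < k} + 1 := by
      refine (card_le_card ?_).trans (card_insert_le i _)
      intro l hl
      simp only [mem_filter, mem_univ, true_and, mem_insert] at hl ⊢
      by_cases h : l = i
      · exact Or.inl h
      · rw [hcg l h] at hl; exact Or.inr hl
    have h3 : weight V' o univ f + 1 ≤ weight V o univ f := by
      rw [weight_slice (mem_univ i), weight_slice (mem_univ i), ← add_sum_erase (V i) _ hv, hVi,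
        add_comm]
      refine add_le_add (Nat.one_le_iff_ne_zero.2 (hfull i v hv)) (le_of_eq ?_)
      exact sum_congr rfl fun w _ => weight_congr fun l hl => hcg l (ne_of_mem_erase hl)
    rw [hcg p hip.symm, hcg q hiq.symm] at h1
    omega
  · push Not at hex
    have hpriv : ∀ v ∈ V i, ∃ j ∈ univ.erase i, ∃ u ∈ V j, ∀ v' ∈ V i, v' ≠ v →
        weight V o ((univ.erase i).erase j) (slice j u (slice i v' f)) = 0 := by
      intro v hv
      obtain ⟨j, hj⟩ := hex v hv
      simp only [Full, not_forall, not_not] at hj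
      obtain ⟨u, hu, h0⟩ := hj
      -- Deleting `v` keeps all edges at the other vertices of class `i`, so the isolated vertex
      -- lies in another class.
      by_cases hji : j = i
      · subst hji
        rw [weight_congr (V' := V) fun l hl => hcongr v l (ne_of_mem_erase hl)] at h0
        rw [Function.update_self] at hu
        exact absurd h0 (hfull j u (mem_of_mem_erase hu))
      · refine ⟨j, mem_erase.2 ⟨hji, mem_univ _⟩, u, by rwa [hcongr v j hji] at hu,
          fun v' hv' hne => ?_⟩
        rw [weight_slice_slice (mem_univ i) (Ne.symm hji), sum_eq_zero_iff] at h0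
        have := h0 v' (by rw [Function.update_self]; exact mem_erase.2 ⟨hne, hv'⟩)
        rwa [weight_congr (V' := V) fun l hl =>
          hcongr v l (ne_of_mem_erase (mem_of_mem_erase hl))] at this
    have key := bound_of_private_vertices (S := univ.erase i) (I := V i)
      (F := fun v => slice i v f) hk4 (fun v hv v' hv' => hf.slice_add (mem_univ i) hv hv')
      (fun l _ => hV l) hi (fun j hj w hw => by
        have := hfull j w hw
        rw [weight_slice_slice (mem_univ i) (ne_of_mem_erase hj).symm] at this
        exact exists_ne_zero_of_sum_ne_zero this) hpriv
      (mem_erase.2 ⟨hip.symm, mem_univ p⟩) (mem_erase.2 ⟨hiq.symm, mem_univ q⟩) hpq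
    rw [← weight_slice (mem_univ i)] at key
    have hΓ := two_mul_sum_min_add_le (Fintype.card ι - 2) hk
    -- The 2 accounts for `p` and `q`, which may be small themselves.
    have hsmall : #{l ∈ univ.erase i | #(V l) < k} ≤
        #{l | l ≠ p ∧ l ≠ q ∧ #(V l) < k} + 2 := by
      refine (card_le_card (t := insert p (insert q
        ({l | l ≠ p ∧ l ≠ q ∧ #(V l) < k} : Finset ι))) ?_).trans
        ((card_insert_le _ _).trans (Nat.add_le_add_right (card_insert_le _ _) 1))
      intro l hl
      simp only [mem_filter, mem_univ, true_and, mem_insert] at hl ⊢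
      tauto
    obtain ⟨d, rfl⟩ := Nat.exists_eq_add_of_le hk4
    rw [show 4 + d - 1 = 3 + d by omega, show 4 + d - 2 = 2 + d by omega] at key
    -- The two cases come down to `k² - 9k + 22 ≥ 0` and `(k - 3)(k - 4) ≥ 0`.
    rcases key with key | key
    · nlinarith [Nat.zero_le (d * (d - 1)), Nat.le_mul_self d]
    · nlinarith

end Bound

/-! ### From octahedral systems to indicator functions -/

section Transfer

variable {α : Type*} [DecidableEq α] {n : ℕ} (Ω : OctahedralSystem α n) {o : Fin n → α}

/-- The indicator function of the edges, on tuples of vertices. -/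
def indicator (x : Fin n → α) : ZMod 2 := if univ.image x ∈ Ω.edges then 1 else 0

variable {Ω}

lemma mem_box_univ {x : Fin n → α} : x ∈ box Ω.part o univ ↔ ∀ l, x l ∈ Ω.part l := by
  simp [mem_box]

lemma eq_of_mem_part {i j : Fin n} {v : α} (hi : v ∈ Ω.part i) (hj : v ∈ Ω.part j) : i = j := by
  by_contra h
  exact disjoint_left.1 (Ω.part_disjoint i j h) hi hj

lemma eq_of_image_eq {x y : Fin n → α} (hx : ∀ l, x l ∈ Ω.part l) (hy : ∀ l, y l ∈ Ω.part l)
    (h : univ.image x = univ.image y) : x = y := by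
  funext l
  have : x l ∈ univ.image y := h ▸ mem_image_of_mem x (mem_univ l)
  obtain ⟨l', -, hl'⟩ := mem_image.1 this
  obtain rfl := eq_of_mem_part (hl' ▸ hy l') (hx l)
  exact hl'.symm

lemma exists_image_eq {e : Finset α} (he : e ∈ Ω.edges) :
    ∃ x : Fin n → α, (∀ l, x l ∈ Ω.part l) ∧ univ.image x = e := by
  choose x hx using fun l => card_eq_one.1 (Ω.card_edge_inter_part e he l)
  have hxe : ∀ l, x l ∈ e ∧ x l ∈ Ω.part l := fun l =>
    mem_inter.1 (by rw [hx l]; exact mem_singleton_self _)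
  refine ⟨x, fun l => (hxe l).2, ?_⟩
  ext v
  simp only [mem_image, mem_univ, true_and]
  constructor
  · rintro ⟨l, rfl⟩; exact (hxe l).1
  · intro hv
    obtain ⟨l, -, hl⟩ := mem_biUnion.1 (Ω.edge_subset e he hv)
    have : v ∈ e ∩ Ω.part l := mem_inter.2 ⟨hv, hl⟩
    rw [hx l] at this
    exact ⟨l, (mem_singleton.1 this).symm⟩

lemma weight_indicator_le : weight Ω.part o univ Ω.indicator ≤ #Ω.edges := by
  refine card_le_card_of_injOn (fun x => univ.image x) ?_ ?_
  · intro x hx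
    have := (mem_filter.1 (mem_coe.1 hx)).2
    by_contra h
    exact this (if_neg h)
  · intro x hx y hy hxy
    exact eq_of_image_eq (mem_box_univ.1 (mem_filter.1 (mem_coe.1 hx)).1)
      (mem_box_univ.1 (mem_filter.1 (mem_coe.1 hy)).1) hxy

lemma WithoutIsolatedVertex.full (hΩ : Ω.WithoutIsolatedVertex) (l : Fin n) :
    Full Ω.part o univ l Ω.indicator := by
  intro w hw
  obtain ⟨e, he, hwe⟩ := hΩ w (mem_biUnion.2 ⟨l, mem_univ l, hw⟩)
  obtain ⟨x, hx, rfl⟩ := exists_image_eq he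
  obtain ⟨l', -, rfl⟩ := mem_image.1 hwe
  obtain rfl := eq_of_mem_part hw (hx l')
  refine weight_ne_zero.2 ⟨Function.update x l (o l), mem_box.2 ⟨fun i hi => ?_, fun i hi => ?_⟩, ?_⟩
  · rw [Function.update_of_ne (ne_of_mem_erase hi)]
    exact hx i
  · have : i = l := by simpa using hi
    subst this; simp
  · simp [slice, indicator, he]

-- If `a` and `b` share a coordinate, the terms cancel in pairs. Otherwise their vertices form a set
-- `X` with two vertices per class, and the cube sum counts the edges inside `X`.
variable (Ω) in
lemma isOct_indicator : IsOct Ω.part o univ Ω.indicator := by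
  intro a ha b hb
  rw [mem_box_univ] at ha hb
  by_cases hab : ∃ l, a l = b l
  · obtain ⟨l, hl⟩ := hab
    rw [← insert_erase (mem_univ l), sum_powerset_insert (notMem_erase l _), ← sum_add_distrib]
    refine sum_eq_zero fun T _ => ?_
    have : (insert l T).piecewise a b = T.piecewise a b := by
      funext i
      by_cases hi : i = l
      · subst hi; by_cases hT : i ∈ T <;> simp [hT, hl]
      · by_cases hT : i ∈ T <;> simp [hT, hi]
    rw [this]
    exact CharTwo.add_self_eq_zero _
  push Not at hab
  have hpw : ∀ T : Finset (Fin n), ∀ l, T.piecewise a b l ∈ Ω.part l := fun T l => by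
    by_cases hT : l ∈ T <;> simp [hT, ha l, hb l]
  set X := univ.image a ∪ univ.image b with hX
  have hXi : ∀ l, X ∩ Ω.part l = {a l, b l} := by
    intro l
    ext v
    simp only [hX, mem_inter, mem_union, mem_image, mem_univ, true_and, mem_insert, mem_singleton]
    constructor
    · rintro ⟨⟨i, rfl⟩ | ⟨i, rfl⟩, hv⟩
      · obtain rfl := eq_of_mem_part (ha i) hv; exact Or.inl rfl
      · obtain rfl := eq_of_mem_part (hb i) hv; exact Or.inr rfl
    · rintro (rfl | rfl)
      · exact ⟨Or.inl ⟨l, rfl⟩, ha l⟩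
      · exact ⟨Or.inr ⟨l, rfl⟩, hb l⟩
  have hXsub : X ⊆ univ.biUnion Ω.part := by
    intro v hv
    simp only [hX, mem_union, mem_image, mem_univ, true_and] at hv
    rcases hv with ⟨i, rfl⟩ | ⟨i, rfl⟩
    · exact mem_biUnion.2 ⟨i, mem_univ i, ha i⟩
    · exact mem_biUnion.2 ⟨i, mem_univ i, hb i⟩
  have heven := Ω.parity X hXsub fun l => by rw [hXi l, card_pair (hab l)]
  have hcard : #{T ∈ (univ : Finset (Fin n)).powerset | univ.image (T.piecewise a b) ∈ Ω.edges} =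
      #{e ∈ Ω.edges | e ⊆ X} := by
    refine card_bij (fun T _ => univ.image (T.piecewise a b)) ?_ ?_ ?_
    · intro T hT
      refine mem_filter.2 ⟨(mem_filter.1 hT).2, fun v hv => ?_⟩
      obtain ⟨l, -, rfl⟩ := mem_image.1 hv
      by_cases hl : l ∈ T <;> simp [hl, hX]
    · intro T _ T' _ h
      have h := eq_of_image_eq (hpw T) (hpw T') h
      ext l
      have hl := congrFun h l
      by_cases h1 : l ∈ T <;> by_cases h2 : l ∈ T' <;> simp_all
      exact hab l hl.symm
    · intro e he
      obtain ⟨he, heX⟩ := mem_filter.1 he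
      obtain ⟨x, hx, rfl⟩ := exists_image_eq he
      have hx' : ({l | x l = a l} : Finset (Fin n)).piecewise a b = x := by
        funext l
        by_cases hl : x l = a l
        · simp [hl]
        · have : x l ∈ X ∩ Ω.part l :=
            mem_inter.2 ⟨heX (mem_image_of_mem x (mem_univ l)), hx l⟩
          rw [hXi l] at this
          simp only [mem_insert, mem_singleton, hl, false_or] at this
          rw [piecewise_eq_of_notMem _ _ _ (by simpa using hl), this]
      exact ⟨_, mem_filter.2 ⟨by simp, by rwa [hx']⟩, by rw [hx']⟩
  simp only [indicator]
  rw [sum_boole, hcard]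
  exact (ZMod.natCast_eq_zero_iff_even).2 heven

lemma WithoutIsolatedVertex.card_add_card_le (hΩ : Ω.WithoutIsolatedVertex) {p q : Fin n}
    (hpq : p ≠ q) : #(Ω.part p) + #(Ω.part q) ≤ #Ω.edges + 2 := by
  choose o _ using fun l => card_pos.1 (lt_of_lt_of_le two_pos (Ω.two_le_card_part l))
  exact (card_add_card_le_weight (o := o) (fun l _ => Ω.two_le_card_part l) Ω.isOct_indicator
    (mem_univ p) (mem_univ q) hpq (hΩ.full p) (hΩ.full q)).trans
    (Nat.add_le_add_right weight_indicator_le 2)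

lemma WithoutIsolatedVertex.card_add_card_add_sum_le (hΩ : Ω.WithoutIsolatedVertex) {p q : Fin n}
    (hpq : p ≠ q) {k : ℕ} (hk : 3 ≤ k) (hV : ∀ l, k - 1 ≤ #(Ω.part l)) :
    #(Ω.part p) + #(Ω.part q) + ∑ l ∈ Icc 4 k, min l (n - 2) ≤
      #Ω.edges + 2 + #{l | l ≠ p ∧ l ≠ q ∧ #(Ω.part l) < k} := by
  choose o _ using fun l => card_pos.1 (lt_of_lt_of_le two_pos (Ω.two_le_card_part l))
  have h1 := card_add_card_add_sum_le_weight (o := o) hpq hk hV Ω.isOct_indicator hΩ.full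
  rw [Fintype.card_fin] at h1
  have h2 := weight_indicator_le (Ω := Ω) (o := o)
  omega

end Transfer

end OctahedralSystem

/-! ### The three cases of the proposition -/

open OctahedralSystem in
theorem mainTheorem8 {α : Type*} [DecidableEq α] (n k z : ℕ) (m : Fin n → ℕ)
    (hk : 2 ≤ k) (hzk : z < k) (hkn : k ≤ n)
    -- `m = (k-1, …, k-1, k, …, k, m_{k+1}, …, m_n)`, with `z` copies of `k-1`, `k-z` copies of `k`
    (hm_small : ∀ i : Fin n, (i : ℕ) < z → m i = k - 1)
    (hm_mid : ∀ i : Fin n, z ≤ (i : ℕ) → (i : ℕ) < k → m i = k)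
    -- `k ≤ m_{k+1} ≤ … ≤ m_n`
    (hm_large : ∀ i : Fin n, k ≤ (i : ℕ) → k ≤ m i)
    (hm_mono : ∀ i j : Fin n, k ≤ (i : ℕ) → i ≤ j → m i ≤ m j)
    (Ω : OctahedralSystem α n) (hsizes : Ω.HasSizes m) (hΩ : Ω.WithoutIsolatedVertex) :
    (k + 2 ≤ n →
      (1 / 2 : ℝ) * (k : ℝ) ^ 2 + (1 / 2 : ℝ) * (k : ℝ) - 8
        + ((Ω.part ⟨n - 2, by omega⟩).card : ℝ) + ((Ω.part ⟨n - 1, by omega⟩).card : ℝ) - (z : ℝ)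
        ≤ (Ω.edges.card : ℝ)) ∧
    (k + 1 = n →
      (1 / 2 : ℝ) * (n : ℝ) ^ 2 + (1 / 2 : ℝ) * (n : ℝ) - 10
        + ((Ω.part ⟨n - 1, by omega⟩).card : ℝ) - (z : ℝ)
        ≤ (Ω.edges.card : ℝ)) ∧
    (k = n →
      (1 / 2 : ℝ) * (n : ℝ) ^ 2 + (5 / 2 : ℝ) * (n : ℝ) - 11 - (z : ℝ)
        ≤ (Ω.edges.card : ℝ)) := by
  have hpart : ∀ i, #(Ω.part i) = m i := hsizes
  have hpq : (⟨n - 2, by omega⟩ : Fin n) ≠ ⟨n - 1, by omega⟩ := by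
    rw [Ne, Fin.mk.injEq]; omega
  -- For `k = 2` the bound `|V_p| + |V_q| - 2` already suffices.
  obtain rfl | hk3 : k = 2 ∨ 3 ≤ k := by omega
  · have h := hΩ.card_add_card_le hpq
    have hp := Ω.two_le_card_part ⟨n - 2, by omega⟩
    have hz : (0 : ℝ) ≤ z := Nat.cast_nonneg z
    rify at h hp
    refine ⟨fun _ => ?_, fun hn => ?_, fun hn => ?_⟩
    · norm_num; linarith
    · have hn' : (n : ℝ) = 3 := by exact_mod_cast hn.symm
      rw [hn']; norm_num; linarith
    · have hn' : (n : ℝ) = 2 := by exact_mod_cast hn.symm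
      have hE := Nat.cast_nonneg (α := ℝ) #Ω.edges
      rw [hn']; norm_num; linarith
  have hm : ∀ i, k - 1 ≤ m i := fun i => by
    rcases lt_or_ge (i : ℕ) z with h | h
    · exact (hm_small i h).ge
    · rcases lt_or_ge (i : ℕ) k with h' | h'
      · have := hm_mid i h h'; omega
      · have := hm_large i h'; omega
  have key := hΩ.card_add_card_add_sum_le hpq hk3 (fun l => (hm l).trans_eq (hpart l).symm)
  have hZ : #{l | l ≠ ⟨n - 2, by omega⟩ ∧ l ≠ ⟨n - 1, by omega⟩ ∧ #(Ω.part l) < k} ≤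
      min z (n - 2) := by
    rw [← card_range (min z (n - 2))]
    refine card_le_card_of_injOn Fin.val ?_ Fin.val_injective.injOn
    intro l hl
    obtain ⟨-, h1, h2, h3⟩ := mem_filter.1 (mem_coe.1 hl)
    rw [Ne, Fin.ext_iff] at h1 h2
    have hlz : (l : ℕ) < z := by
      by_contra! h
      rw [hpart l] at h3
      rcases lt_or_ge (l : ℕ) k with h' | h'
      · have := hm_mid l h h'; omega
      · have := hm_large l h'; omega
    have := l.isLt
    simp only [coe_range, Set.mem_Iio]
    simp only at h1 h2
    omega
  have hlarge : ∀ i : Fin n, z ≤ (i : ℕ) → k ≤ #(Ω.part i) := fun i hi => by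
    rw [hpart]
    rcases lt_or_ge (i : ℕ) k with h' | h'
    · exact (hm_mid i hi h').ge
    · exact hm_large i h'
  have hp1 : k - 1 ≤ #(Ω.part ⟨n - 2, by omega⟩) := (hm _).trans_eq (hpart _).symm
  have hp := hlarge ⟨n - 2, by omega⟩
  have hq := hlarge ⟨n - 1, by omega⟩ (by simp only; omega)
  simp only at hp
  generalize #(Ω.part ⟨n - 2, by omega⟩) = a at *
  generalize #(Ω.part ⟨n - 1, by omega⟩) = b at *
  generalize #Ω.edges = E at *
  generalize #{l | l ≠ ⟨n - 2, by omega⟩ ∧ l ≠ ⟨n - 1, by omega⟩ ∧ #(Ω.part l) < k} = Z at *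
  refine ⟨fun hn => ?_, fun hn => ?_, fun hn => ?_⟩
  · have hΓ := two_mul_sum_min_add (m := n - 2) hk3 (by omega)
    have h : a + b + ∑ l ∈ Icc 4 k, min l (n - 2) ≤ E + 2 + z := by omega
    rify at h hΓ
    linarith
  -- The closed form is applied up to `n - 2`, which must be at least 3; the top term is `n - 2`
  -- instead of `k`.
  · obtain rfl | hn5 : n = 4 ∨ 5 ≤ n := by omega
    · have h : b ≤ E + z := by omega
      rify at h
      norm_num
      linarith
    · obtain ⟨d, rfl⟩ := Nat.exists_eq_add_of_le hn5
      obtain rfl : k = d + 3 + 1 := by omega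
      have hΓ := two_mul_sum_min_add (m := d + 3) (k := d + 3) (by omega) le_rfl
      rw [show 5 + d - 2 = d + 3 by omega] at key hZ hp
      rw [sum_Icc_succ_top (by omega)] at key
      have hap := hp (by omega)
      have h : d + 4 + b + (∑ l ∈ Icc 4 (d + 3), min l (d + 3) + (d + 3)) ≤ E + 2 + z := by omega
      rify at h hΓ
      push_cast
      linarith
  · obtain rfl | rfl | hn5 : n = 3 ∨ n = 4 ∨ 5 ≤ n := by omega
    · have hE := Nat.cast_nonneg (α := ℝ) E
      have h : 1 ≤ E + z := by omega
      rify at h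
      norm_num
      linarith
    · subst hn
      have hΓ : ∑ l ∈ Icc 4 4, min l (4 - 2) = 2 := rfl
      have h : 8 ≤ E + z := by omega
      rify at h
      norm_num
      linarith
    · obtain ⟨d, rfl⟩ := Nat.exists_eq_add_of_le hn5
      obtain rfl : k = d + 3 + 1 + 1 := by omega
      have hΓ := two_mul_sum_min_add (m := d + 3) (k := d + 3) (by omega) le_rfl
      rw [show 5 + d - 2 = d + 3 by omega] at key hZ hp
      rw [sum_Icc_succ_top (by omega), sum_Icc_succ_top (by omega)] at key
      have h : 2 * (d + 5) + (∑ l ∈ Icc 4 (d + 3), min l (d + 3) + 2 * (d + 3)) ≤ E + 2 + z := by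
        -- If `z = n - 1`, the class with index `n - 2` may have only `k - 1` vertices. At most `n -
        -- 2 = z - 1` small classes are counted, which makes up for the missing vertex.
        rcases Nat.lt_or_ge (d + 3) z with h | h
        · omega
        · have := hp h; omega
      rify at h hΓ
      push_cast
      linarith
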